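/- **Setting.** Let $N$ be a finite set of players with actions $\{0,1\}$; identify an action profile with the set $X\subseteq N$ of players taking action $1$, and let $u_i:2^N\to\mathbb R$ ($i\in N$) be the payoffs of the stage game $\Gamma$. For $X\subseteq N\setminus\{i\}$ put $u_i^*(X)=\max\{u_i(X),u_i(X\cup i)\}$. Assume that for all $i\in N$ and $X\subsetneq Y\subseteq N\setminus\{i\}$: 1. (single-crossing) $u_i(X\cup i)\ge u_i(X)\Rightarrow u_i(Y\cup i)\ge u_i(Y)$, and the same with both inequalities strict; 2. (common interests) $u_i^*(X)\le u_i^*(Y)$, with strict inequality if $u_i^*(Y)=u_i(Y\cup i)$ and $u_i^*(X)=u_i(X)$; 3. (deviation-proofness) $u_i(Y\cup i)\ge u_i(X)\Rightarrow u_i(Y\cup i)\ge u_i(Y)$, and the same with both inequalities strict. Fix $T\ge1$. In the *synchronous game* all players act simultaneously in each stage $1,\dots,T$, observing all past actions; a player who has taken action $1$ must keep taking it; payoffs are $u_i$ of the profile of stage $T$. In the *asynchronous game* of a partition $p:N\to\{1,\dots,T\}$ (periods may be empty), each player $i$ acts once, in period $p(i)$, observing all actions of the earlier periods; payoffs are $u_i$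 of the resulting profile. An *MSPNE* is a pure-strategy subgame perfect equilibrium in which every player's strategy is non-decreasing in the history. Let $\varphi_\Gamma(T)$ be the set of players who take action $1$ (at stage $T$) in every MSPNE outcome of the synchronous game. **Recursion.** For disjoint $S,W\subseteq N$ let $\Gamma_{S,W}$ be the stage game with player set $W$ in which the players in $S$ are fixed at $1$ and all others outside $W$ at $0$, so that payoffs are $Y\mapsto u_i(S\cup Y)$, $Y\subseteq W$. Call $X\subseteq W$ strictly sufficient in $\Gamma_{S,W}$ if $u_i(S\cup X)>u_i(S\cup X\setminus i)$ for all $i\in X$, and $i\in W$ dominated if $u_i(S\cup i)>u_i(S)$. Put $\tau(\Gamma_{S,\emptyset})=1$; $\tau(\Gamma_{S,W})=\min_i\tau(\Gamma_{S\cup i,W\setminus i})$ over the dominated $i\in W$ if there are any; and otherwise $$\tau(\Gamma_{S,W})=\min\Big\{1+\min_{i\in W}\tau(\Gamma_{S\cup i,W\setminus i}),\ \min_{X}\max\{\tau(\Gamma_{S,X}),\tau(\Gamma_{S\cup X,W\setminus X})\}\Big\},$$ with $X$ ranging over the strictly sufficient sets of $\Gamma_{S,W}$ other than $\emptyset$ and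 $W$. A *policy function* selects at each $\Gamma_{S,W}$ with $W\ne\emptyset$ an operation attaining this value: dominate $i$, delete $i$, or divide by $X$ (corresponding to the three kinds of terms above). A partition $p$ is *read off* the policy function from $\Gamma_{S,W}$ if, following the operations down to games without players, each player $i$ deleted at a game with player set $W'$ satisfies $p(i)<p(j)$ for all $j\in W'\setminus i$ (dominated players may be placed in any period, the two parts of a divided game are placed independently, and players never reached are placed arbitrarily). **Theorem.** 1. For every partition $p$, the set of MSPNE outcomes of the asynchronous game has a least element (with respect to inclusion); the synchronous game has a least MSPNE outcome, and it equals $\varphi_\Gamma(T)$. 2. The greatest element, over all partitions $p:N\to\{1,\dots,T\}$, of the least MSPNE outcomes of the asynchronous games exists and equals $\varphi_\Gamma(T)$. 3. $\varphi_\Gamma(T)$ is the greatest set $Y$ that is strictly sufficient in $\Gamma_{\emptyset,N}$ and has $\tau(\Gamma_{\emptyset,Y})\le T$ (here $\emptyset$ counts as strictly sufficient). 4. Policy functions exist. For every policy function, some partition $p:N\to\{1,\dots,T\}$ can be read off it from $\Gamma_{\emptyset,\varphi_\Gamma(T)}$, and every partition that can be read off it in this way is optimal: the least MSPNE outcome of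 its asynchronous game is $\varphi_\Gamma(T)$. -/

import Mathlib

/-! Coordination games with binary actions, their synchronous and asynchronous extensions.

The player set is a finite type `N`. An action profile `a ∈ {0,1}^N` is identified with the finite set
`X = {i | a i = 1}` of the players who take action `1`, so a payoff function is `u : N → Finset N → ℝ`;
the order on profiles is inclusion. A profile `a_{-i}` of the opponents of `i` is a set `X` with
`i ∉ X`, and then `u i X = u_i(0, a_{-i})` and `u i (insert i X) = u_i(1, a_{-i})`. -/

namespace Coord

variable {N : Type*} [Fintype N] [DecidableEq N]

/-! ### The stage game -/

/-- `u_i^*(a_{-i})`, the payoff of a best response of `i` to the opponents' profile `X`. -/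
noncomputable def bestPayoff (u : N → Finset N → ℝ) (i : N) (X : Finset N) : ℝ :=
  max (u i X) (u i (insert i X))

/-- The three assumptions on the stage game: single-crossing, common interests, deviation-proofness.
Here `X ⊂ Y` are profiles of the opponents of `i`. -/
structure IsCoordinationGame (u : N → Finset N → ℝ) : Prop where
  single_crossing_weak : ∀ (i : N) (X Y : Finset N), i ∉ Y → X ⊂ Y →
    u i X ≤ u i (insert i X) → u i Y ≤ u i (insert i Y)
  single_crossing_strict : ∀ (i : N) (X Y : Finset N), i ∉ Y → X ⊂ Y →
    u i X < u i (insert i X) → u i Y < u i (insert i Y)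
  common_interests : ∀ (i : N) (X Y : Finset N), i ∉ Y → X ⊂ Y →
    bestPayoff u i X ≤ bestPayoff u i Y
  common_interests_strict : ∀ (i : N) (X Y : Finset N), i ∉ Y → X ⊂ Y →
    bestPayoff u i Y = u i (insert i Y) → bestPayoff u i X = u i X →
      bestPayoff u i X < bestPayoff u i Y
  deviation_proof_weak : ∀ (i : N) (X Y : Finset N), i ∉ Y → X ⊂ Y →
    u i X ≤ u i (insert i Y) → u i Y ≤ u i (insert i Y)
  deviation_proof_strict : ∀ (i : N) (X Y : Finset N), i ∉ Y → X ⊂ Y →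
    u i X < u i (insert i Y) → u i Y < u i (insert i Y)

/-! ### The synchronous (monotone) game

A history is the list of the past action profiles, the most recent one first. In every stage all
players act simultaneously; nobody can return from action `1` to action `0`; the payoff depends on the
profile of the last stage only. -/

/-- The profile played last along a history (`∅` if nothing has been played). -/
def lastProfile (h : List (Finset N)) : Finset N := h.headD ∅

/-- The histories that respect the irreversibility constraint. -/
def IsSyncHistory (h : List (Finset N)) : Prop :=
  h.IsChain (fun newer older => older ⊆ newer)

/-- The strategy `σ` of player `i` respects the irreversibility constraint: after every history of
length less than `T` in which `i` has already taken action `1`, it takes action `1` (`true`). -/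
def IsSyncStrategy (T : ℕ) (i : N) (σ : List (Finset N) → Bool) : Prop :=
  ∀ h : List (Finset N), IsSyncHistory h → h.length < T → i ∈ lastProfile h → σ h = true

/-- The profile that the strategy profile `s` plays after the history `h`. -/
def syncAct (s : N → List (Finset N) → Bool) (h : List (Finset N)) : Finset N :=
  Finset.univ.filter (fun i => s i h = true)

/-- The history reached when `s` is played for `k` further stages after the history `h`. -/
def syncRun (s : N → List (Finset N) → Bool) : ℕ → List (Finset N) → List (Finset N)
  | 0, h => h
  | k + 1, h => syncRun s k (syncAct s h :: h)

/-- The profile played in the last stage `T` if `s` is followed after the history `h`. -/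
def syncOutcomeFrom (T : ℕ) (s : N → List (Finset N) → Bool) (h : List (Finset N)) : Finset N :=
  lastProfile (syncRun s (T - h.length) h)

/-- Subgame perfect Nash equilibrium of the `T`-stage synchronous game, in pure strategies. -/
def IsSyncSPNE (u : N → Finset N → ℝ) (T : ℕ) (s : N → List (Finset N) → Bool) : Prop :=
  (∀ i, IsSyncStrategy T i (s i)) ∧
  ∀ h : List (Finset N), IsSyncHistory h → h.length < T →
    ∀ (i : N) (σ : List (Finset N) → Bool), IsSyncStrategy T i σ →
      u i (syncOutcomeFrom T (Function.update s i σ) h) ≤ u i (syncOutcomeFrom T s h)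

/-- Monotonicity in history: a higher history of the same length is never answered by a lower action. -/
def IsSyncMonotone (T : ℕ) (s : N → List (Finset N) → Bool) : Prop :=
  ∀ (i : N) (h h' : List (Finset N)), IsSyncHistory h → IsSyncHistory h' → h.length < T →
    List.Forall₂ (fun a b => a ⊆ b) h h' → s i h ≤ s i h'

/-- `O(Γ(T))`: the outcomes of the monotonic subgame perfect equilibria (MSPNE) of the `T`-stage
synchronous game. -/
def syncOutcomes (u : N → Finset N → ℝ) (T : ℕ) : Set (Finset N) :=
  {a | ∃ s : N → List (Finset N) → Bool,
    IsSyncSPNE u T s ∧ IsSyncMonotone T s ∧ syncOutcomeFrom T s [] = a}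

open Classical in
/-- `φ_Γ(T)`: the set of the players who take action `1` in all MSPNE of the `T`-stage synchronous
game. -/
noncomputable def phi (u : N → Finset N → ℝ) (T : ℕ) : Finset N :=
  Finset.univ.filter (fun i => ∀ Y ∈ syncOutcomes u T, i ∈ Y)

/-! ### The asynchronous game

A partition of the players into `T` (possibly empty) periods is a map `p : N → Fin T`; the players `i`
with `p i = t` act simultaneously in period `t`. The history before period `t` consists of the actions
of the players of the earlier periods, that is, of the set of those among them who took action `1`. -/

/-- The histories before period `t` (periods are numbered `0, …, T - 1`). -/
def IsAsyncHistory {T : ℕ} (p : N → Fin T) (t : ℕ) (h : Finset N) : Prop :=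
  ∀ j ∈ h, (p j : ℕ) < t

/-- The outcome when `s` is followed for the `k` periods `t, …, t + k - 1` after the history `h`. -/
def asyncRun {T : ℕ} (p : N → Fin T) (s : N → Finset N → Bool) : ℕ → ℕ → Finset N → Finset N
  | 0, _, h => h
  | k + 1, t, h =>
      asyncRun p s k (t + 1) (h ∪ Finset.univ.filter (fun i => (p i : ℕ) = t ∧ s i h = true))

/-- The final profile if `s` is followed from period `t` on, after the history `h`. -/
def asyncOutcomeFrom {T : ℕ} (p : N → Fin T) (s : N → Finset N → Bool) (t : ℕ) (h : Finset N) :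
    Finset N :=
  asyncRun p s (T - t) t h

/-- Subgame perfect Nash equilibrium of the asynchronous game, in pure strategies. -/
def IsAsyncSPNE (u : N → Finset N → ℝ) {T : ℕ} (p : N → Fin T) (s : N → Finset N → Bool) : Prop :=
  ∀ (t : ℕ) (h : Finset N), t < T → IsAsyncHistory p t h →
    ∀ (i : N) (σ : Finset N → Bool),
      u i (asyncOutcomeFrom p (Function.update s i σ) t h) ≤ u i (asyncOutcomeFrom p s t h)

/-- Monotonicity in history. -/
def IsAsyncMonotone {T : ℕ} (p : N → Fin T) (s : N → Finset N → Bool) : Prop :=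
  ∀ (i : N) (h h' : Finset N), IsAsyncHistory p (p i) h → IsAsyncHistory p (p i) h' →
    h ⊆ h' → s i h ≤ s i h'

/-- The outcomes of the MSPNE of the asynchronous game with partition `p`. -/
def asyncOutcomes (u : N → Finset N → ℝ) {T : ℕ} (p : N → Fin T) : Set (Finset N) :=
  {a | ∃ s : N → Finset N → Bool,
    IsAsyncSPNE u p s ∧ IsAsyncMonotone p s ∧ asyncOutcomeFrom p s 0 ∅ = a}

/-! ### The recursion and its policy function -/

/-- An auxiliary stage game obtained from `Γ`: only the players in `active` still play, those in
`raised` act as if fixed at action `1`, and all others act as if fixed at action `0`. -/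
structure AuxGame (N : Type*) where
  raised : Finset N
  active : Finset N

/-- The original stage game. -/
def AuxGame.full (N : Type*) [Fintype N] : AuxGame N := ⟨∅, Finset.univ⟩

/-- The game with player set `X` in which the removed active players are fixed at action `1`. -/
def AuxGame.over (A : AuxGame N) (X : Finset N) : AuxGame N := ⟨A.raised ∪ (A.active \ X), X⟩

/-- The game with player set `X` in which the removed active players are fixed at action `0`. -/
def AuxGame.under (A : AuxGame N) (X : Finset N) : AuxGame N := ⟨A.raised, X⟩

/-- The payoff function of an auxiliary game, for `Y ⊆ A.active`. -/
def AuxGame.payoff (u : N → Finset N → ℝ) (A : AuxGame N) (i : N) (Y : Finset N) : ℝ :=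
  u i (A.raised ∪ Y)

/-- `X` is a strictly sufficient set of the auxiliary game: all its members strictly prefer action `1`
given that exactly the others in `X` take it. -/
def IsSSS (u : N → Finset N → ℝ) (A : AuxGame N) (X : Finset N) : Prop :=
  X ⊆ A.active ∧ ∀ i ∈ X, A.payoff u i (X.erase i) < A.payoff u i X

/-- Player `i` strictly prefers action `1` even if no other active player takes it. -/
def IsDominated (u : N → Finset N → ℝ) (A : AuxGame N) (i : N) : Prop :=
  i ∈ A.active ∧ A.payoff u i ∅ < A.payoff u i {i}

open Classical in
/-- The value function `τ` of the synchronous recursion: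
* `τ = 1` if there are no players;
* `τ(Γ) = τ(Γ̄(N \ i))` if `i` strictly prefers action `1` when all others take `0`
  (minimized over such `i`);
* otherwise `τ(Γ) = min {1 + min_i τ(Γ̄(N \ i)), min_X max {τ(Γ̲(X)), τ(Γ̄(N \ X))}}`, with `X` ranging
  over the strictly sufficient sets other than `∅` and `N`. -/
noncomputable def tau (u : N → Finset N → ℝ) (A : AuxGame N) : ℕ :=
  if A.active = ∅ then 1
  else if ∃ i, IsDominated u A i then
    sInf {k | ∃ (i : N) (_ : IsDominated u A i), k = tau u (A.over (A.active.erase i))}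
  else
    sInf ({k | ∃ (i : N) (_ : i ∈ A.active), k = 1 + tau u (A.over (A.active.erase i))} ∪
      {k | ∃ (X : Finset N) (_ : IsSSS u A X ∧ X.Nonempty ∧ X ≠ A.active),
        k = max (tau u (A.under X)) (tau u (A.over (A.active \ X)))})
termination_by A.active.card
decreasing_by
  · rename_i h
    exact Finset.card_erase_lt_of_mem h.1
  · rename_i h
    exact Finset.card_erase_lt_of_mem h
  · rename_i h
    exact Finset.card_lt_card (lt_of_le_of_ne h.1.1 h.2.2)
  · rename_i h
    exact Finset.card_lt_card (Finset.sdiff_ssubset h.1.1 h.2.1)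

/-- The three operations of a policy. -/
inductive Op (N : Type*) where
  | dominate (i : N) : Op N
  | delete (i : N) : Op N
  | divide (X : Finset N) : Op N

/-- `π` is a policy function of the recursion: at every auxiliary game with at least one active player
it selects an operation that is admissible there and attains the value `τ`. -/
def IsPolicyFunction (u : N → Finset N → ℝ) (π : AuxGame N → Op N) : Prop :=
  ∀ A : AuxGame N, A.active.Nonempty →
    match π A with
    | Op.dominate i => IsDominated u A i ∧ tau u A = tau u (A.over (A.active.erase i))
    | Op.delete i => (¬ ∃ j, IsDominated u A j) ∧ i ∈ A.active ∧
        tau u A = 1 + tau u (A.over (A.active.erase i))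
    | Op.divide X => (¬ ∃ j, IsDominated u A j) ∧ (IsSSS u A X ∧ X.Nonempty ∧ X ≠ A.active) ∧
        tau u A = max (tau u (A.under X)) (tau u (A.over (A.active \ X)))

/-- The partition `p` is read off the policy function `π`, started at the auxiliary game `A`: a deleted
player acts strictly before all players that are still active, the two parts of a divided game are
arranged independently of each other, and a dominated player may act in any period. -/
inductive ReadOff (π : AuxGame N → Op N) {T : ℕ} (p : N → Fin T) : AuxGame N → Prop
  | done (A : AuxGame N) (hA : A.active = ∅) : ReadOff π p A
  | dominate (A : AuxGame N) (i : N) (hA : A.active.Nonempty) (hπ : π A = Op.dominate i)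
      (h : ReadOff π p (A.over (A.active.erase i))) : ReadOff π p A
  | delete (A : AuxGame N) (i : N) (hA : A.active.Nonempty) (hπ : π A = Op.delete i)
      (hi : ∀ j ∈ A.active.erase i, p i < p j)
      (h : ReadOff π p (A.over (A.active.erase i))) : ReadOff π p A
  | divide (A : AuxGame N) (X : Finset N) (hA : A.active.Nonempty) (hπ : π A = Op.divide X)
      (h₁ : ReadOff π p (A.under X)) (h₂ : ReadOff π p (A.over (A.active \ X))) : ReadOff π p A

end Coord

/-!
Everything reduces to the relation `Prefers u i B`: player `i` strictly prefers action `1` when the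
opponents play `B \ i`. It is monotone in `B` (`prefers_mono`), and whenever `A ⊆ B`, `i ∉ A`, `i ∈ B`,
the outcome `B` is strictly better than `A` for `i` if and only if `Prefers u i B`
(`lt_iff_prefers`). Hence in a dynamic game with monotone continuation a player compares outcomes by
looking only at the larger one.

Let `C 0 = id`, and let `C (k + 1) X` be the least `Z ⊇ X` such that `Prefers u i (C k (Z ∪ i))` only
for `i ∈ Z`. Each `C k` is a closure operator, and all members of `C k X \ X` strictly prefer action
`1` at `C k X`. In the synchronous game with `k` stages left after the profile `a`:

* playing `C k a` at once is a monotone equilibrium with outcome `C k a` (`isSyncSPNE_leastSyncStrategy`),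
  because a deviation leads to `C k a` itself, to `C k a` without the deviator, or to some
  `C r (C k a ∪ i)` with `r < k`;
* the outcome of every monotone equilibrium is closed under `C k` (`syncOutcome_closed`).

So the least outcome is `C T ∅`. In an asynchronous game, backward induction with the least equilibrium
of every period gives the least outcome (`isLeast_asyncOutcomes`), and it is contained in
`C T ∅` (`asyncLeast_subset_syncClosure`).

Conversely, suppose that the active players of an auxiliary game form a strictly sufficient set and
that `p` is read off a policy from it. Then an outcome of an equilibrium, in any subgame in which
these players still have to move, contains all of them as soon as it contains the raised players
(`ReadOff.active_subset`): a deleted player who moves first triggers the others. A partition into `T`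
periods can be read off whenever `τ ≤ T` (`exists_readOff`), and `τ ≤ k` for `k ≥ 1` at the game with
raised players `S` and active players `C k S \ S` (`tau_syncClosure_le`). Hence `C T ∅` is attained by the
partitions read off, and it contains every strictly sufficient set with `τ ≤ T`.
-/

namespace Coord

variable {N : Type*} [Fintype N] [DecidableEq N]

/-! ### Strict preference for action 1 -/

/-- Player `i` strictly prefers action `1` when exactly the players in `B \ i` take it; whether
`i ∈ B` is irrelevant. -/
def Prefers (u : N → Finset N → ℝ) (i : N) (B : Finset N) : Prop :=
  u i (B.erase i) < u i (insert i B)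

omit [Fintype N] in
theorem prefers_mono {u : N → Finset N → ℝ} (hu : IsCoordinationGame u) (i : N) :
    Monotone (Prefers u i) := by
  intro B B' hB h
  have hins : ∀ B : Finset N, insert i (B.erase i) = insert i B := fun B => by grind
  rcases eq_or_ne (B.erase i) (B'.erase i) with e | e
  · have : insert i B = insert i B' := by
      rw [← hins, e, hins]
    unfold Prefers at *
    rwa [← e, ← this]
  · have := hu.single_crossing_strict i (B.erase i) (B'.erase i) (by simp)
      (lt_of_le_of_ne (Finset.erase_subset_erase i hB) e)
    rw [hins, hins] at this
    exact this h

omit [Fintype N] in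
/-- An outcome in which `i` takes action `1` is strictly better for `i` than a smaller outcome in which
`i` takes action `0` if and only if action `1` is the strict best response at the larger outcome:
deviation-proofness gives one direction, common interests the other. -/
theorem lt_iff_prefers {u : N → Finset N → ℝ} (hu : IsCoordinationGame u) {i : N}
    {A B : Finset N} (hAB : A ⊆ B) (hA : i ∉ A) (hB : i ∈ B) :
    u i A < u i B ↔ Prefers u i B := by
  unfold Prefers
  rw [Finset.insert_eq_of_mem hB]
  rcases eq_or_ne A (B.erase i) with e | e
  · rw [← e]
  · have hss : A ⊂ B.erase i := lt_of_le_of_ne (Finset.subset_erase.2 ⟨hAB, hA⟩) e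
    have hdev := hu.deviation_proof_strict i A (B.erase i) (by simp) hss
    have hci := hu.common_interests i A (B.erase i) (by simp) hss
    have hcs := hu.common_interests_strict i A (B.erase i) (by simp) hss
    unfold bestPayoff at hci hcs
    rw [Finset.insert_erase hB] at hdev hci hcs
    refine ⟨hdev, fun h => ?_⟩
    rw [max_eq_right h.le] at hci hcs
    rcases le_or_gt (u i (insert i A)) (u i A) with h' | h'
    · rw [max_eq_left h'] at hcs
      exact hcs rfl rfl
    · rw [max_eq_right h'.le] at hci
      exact h'.trans_le hci

/-! ### Least sets closed under a monotone demand -/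

open Classical in
/-- The least `Z ⊇ X` that contains every `j` for which `Q j (insert j Z)` holds. -/
noncomputable def leastClosed (Q : N → Finset N → Prop) (X : Finset N) : Finset N :=
  Finset.univ.filter (fun i => ∀ Z, X ⊆ Z → (∀ j, Q j (insert j Z) → j ∈ Z) → i ∈ Z)

section LeastClosed

variable {Q : N → Finset N → Prop} {X Y Z : Finset N}

theorem subset_leastClosed : X ⊆ leastClosed Q X := by
  intro i hi
  simp only [leastClosed, Finset.mem_filter, Finset.mem_univ, true_and]
  exact fun Z hZ _ => hZ hi

theorem leastClosed_subset (hXZ : X ⊆ Z) (hZ : ∀ j, Q j (insert j Z) → j ∈ Z) :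
    leastClosed Q X ⊆ Z := by
  intro i hi
  simp only [leastClosed, Finset.mem_filter, Finset.mem_univ, true_and] at hi
  exact hi Z hXZ hZ

theorem leastClosed_mono : Monotone (leastClosed Q) := by
  intro X Y hXY i hi
  simp only [leastClosed, Finset.mem_filter, Finset.mem_univ, true_and] at hi ⊢
  exact fun Z hZ => hi Z (hXY.trans hZ)

theorem mem_leastClosed_of_demand (hQ : ∀ i, Monotone (Q i)) {j : N}
    (h : Q j (insert j (leastClosed Q X))) : j ∈ leastClosed Q X := by
  simp only [leastClosed, Finset.mem_filter, Finset.mem_univ, true_and]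
  exact fun Z hXZ hZ =>
    hZ j (hQ j (Finset.insert_subset_insert j (leastClosed_subset hXZ hZ)) h)

/-- Members of the least closed set that were not there at the start demand to be in it: otherwise
they could be removed. -/
theorem demand_of_mem_leastClosed (hQ : ∀ i, Monotone (Q i)) {i : N}
    (hi : i ∈ leastClosed Q X) (hX : i ∉ X) : Q i (leastClosed Q X) := by
  by_contra hcon
  have hsub : leastClosed Q X ⊆ (leastClosed Q X).erase i := by
    refine leastClosed_subset (Finset.subset_erase.2 ⟨subset_leastClosed, hX⟩) fun j hj => ?_
    rcases eq_or_ne j i with rfl | hne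
    · rw [Finset.insert_erase hi] at hj
      exact absurd hj hcon
    · exact Finset.mem_erase.2 ⟨hne, mem_leastClosed_of_demand hQ
        (hQ j (Finset.insert_subset_insert j (Finset.erase_subset _ _)) hj)⟩
  exact absurd (hsub hi) (Finset.notMem_erase i _)

end LeastClosed

/-! ### The closure operators of the synchronous game -/

/-- The least outcome of the synchronous game with `k` stages left, as a function of the last
profile. -/
noncomputable def syncClosure (P : N → Finset N → Prop) : ℕ → Finset N → Finset N
  | 0, X => X
  | k + 1, X => leastClosed (fun i Z => P i (syncClosure P k Z)) X

section SyncClosure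

variable {P : N → Finset N → Prop}

theorem syncClosure_mono (k : ℕ) : Monotone (syncClosure P k) := by
  cases k with
  | zero => exact fun _ _ h => h
  | succ k => exact leastClosed_mono

theorem subset_syncClosure (k : ℕ) (X : Finset N) : X ⊆ syncClosure P k X := by
  cases k with
  | zero => exact subset_rfl
  | succ k => exact subset_leastClosed

theorem monotone_demand (hP : ∀ i, Monotone (P i)) (k : ℕ) (i : N) :
    Monotone (fun Z => P i (syncClosure P k Z)) :=
  (hP i).comp (syncClosure_mono k)

theorem mem_syncClosure_succ (hP : ∀ i, Monotone (P i)) {k : ℕ} {X : Finset N} {j : N}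
    (h : P j (syncClosure P k (insert j (syncClosure P (k + 1) X)))) :
    j ∈ syncClosure P (k + 1) X :=
  mem_leastClosed_of_demand (monotone_demand hP k) h

/-- Both facts are proved together, since closedness of `C (k + 1) X` under `C k` rests on the
preferences of the members that `C k` would add. -/
theorem syncClosure_aux (hP : ∀ i, Monotone (P i)) (k : ℕ) :
    (∀ X, ∀ i ∈ syncClosure P k X, i ∉ X → P i (syncClosure P k X)) ∧
    ∀ X, syncClosure P k (syncClosure P (k + 1) X) = syncClosure P (k + 1) X := by
  have step : ∀ k, (∀ X, ∀ i ∈ syncClosure P k X, i ∉ X → P i (syncClosure P k X)) →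
      ∀ X, syncClosure P k (syncClosure P (k + 1) X) = syncClosure P (k + 1) X := by
    intro k hk X
    refine (Finset.Subset.antisymm (subset_syncClosure _ _) fun j hj => ?_).symm
    by_contra hn
    exact hn (mem_syncClosure_succ hP
      (monotone_demand hP k j (Finset.subset_insert j _) (hk _ j hj hn)))
  have pref : ∀ k X, ∀ i ∈ syncClosure P k X, i ∉ X → P i (syncClosure P k X) := by
    intro k
    induction k with
    | zero => exact fun X i hi hn => absurd hi hn
    | succ k ih =>
      intro X i hi hn
      have := demand_of_mem_leastClosed (monotone_demand hP k) hi hn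
      rw [← step k ih X]
      exact this
  exact ⟨pref k, step k (pref k)⟩

theorem prefers_of_mem_syncClosure (hP : ∀ i, Monotone (P i)) {k : ℕ} {X : Finset N} {i : N}
    (hi : i ∈ syncClosure P k X) (hX : i ∉ X) : P i (syncClosure P k X) :=
  (syncClosure_aux hP k).1 X i hi hX

theorem syncClosure_syncClosure_succ (hP : ∀ i, Monotone (P i)) (k : ℕ) (X : Finset N) :
    syncClosure P k (syncClosure P (k + 1) X) = syncClosure P (k + 1) X :=
  (syncClosure_aux hP k).2 X

theorem syncClosure_idem (hP : ∀ i, Monotone (P i)) (k : ℕ) (X : Finset N) :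
    syncClosure P k (syncClosure P k X) = syncClosure P k X := by
  cases k with
  | zero => rfl
  | succ k =>
    exact Finset.Subset.antisymm
      (leastClosed_subset subset_rfl fun j hj => mem_syncClosure_succ hP hj)
      (subset_syncClosure _ _)

theorem syncClosure_subset_succ (hP : ∀ i, Monotone (P i)) (k : ℕ) (X : Finset N) :
    syncClosure P k X ⊆ syncClosure P (k + 1) X := by
  rw [← syncClosure_syncClosure_succ hP k X]
  exact syncClosure_mono k (subset_syncClosure _ _)

theorem syncClosure_eq_of_between (hP : ∀ i, Monotone (P i)) {k : ℕ} {X Y : Finset N}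
    (hXY : X ⊆ Y) (hY : Y ⊆ syncClosure P k X) : syncClosure P k Y = syncClosure P k X := by
  refine Finset.Subset.antisymm ?_ (syncClosure_mono k hXY)
  rw [← syncClosure_idem hP k X]
  exact syncClosure_mono k hY

theorem syncClosure_eq_self_of_succ (hP : ∀ i, Monotone (P i)) {k : ℕ} {Z : Finset N}
    (h : syncClosure P (k + 1) Z = Z) : syncClosure P k Z = Z := by
  rw [← h]
  exact syncClosure_syncClosure_succ hP k Z

end SyncClosure

/-! ### The synchronous game -/

section Sync

variable {T : ℕ} {s : N → List (Finset N) → Bool}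

omit [DecidableEq N] in
theorem syncOutcomeFrom_of_length_eq {h : List (Finset N)} (hT : h.length = T) :
    syncOutcomeFrom T s h = lastProfile h := by
  simp [syncOutcomeFrom, hT, syncRun]

omit [DecidableEq N] in
theorem syncOutcomeFrom_of_length_lt {h : List (Finset N)} (hT : h.length < T) :
    syncOutcomeFrom T s h = syncOutcomeFrom T s (syncAct s h :: h) := by
  obtain ⟨k, hk⟩ : ∃ k, T - h.length = k + 1 := ⟨T - h.length - 1, by omega⟩
  have hk' : T - (syncAct s h :: h).length = k := by simp; omega
  simp only [syncOutcomeFrom, hk, hk', syncRun]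

omit [Fintype N] [DecidableEq N] in
theorem IsSyncHistory.cons {h : List (Finset N)} {a : Finset N} (hh : IsSyncHistory h)
    (ha : lastProfile h ⊆ a) : IsSyncHistory (a :: h) := by
  cases h with
  | nil => exact List.isChain_singleton a
  | cons b h => exact List.isChain_cons_cons.2 ⟨ha, hh⟩

omit [DecidableEq N] in
theorem lastProfile_subset_syncAct (hs : ∀ i, IsSyncStrategy T i (s i)) {h : List (Finset N)}
    (hh : IsSyncHistory h) (hT : h.length < T) : lastProfile h ⊆ syncAct s h := by
  intro i hi
  simp [syncAct, hs i h hh hT hi]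

omit [DecidableEq N] in
theorem mem_syncAct {h : List (Finset N)} {i : N} : i ∈ syncAct s h ↔ s i h = true := by
  simp [syncAct]

theorem mem_syncAct_update_of_ne {h : List (Finset N)} {i j : N} {σ : List (Finset N) → Bool}
    (hne : j ≠ i) : j ∈ syncAct (Function.update s i σ) h ↔ j ∈ syncAct s h := by
  simp [syncAct, Function.update_of_ne hne]

theorem mem_syncAct_update_self {h : List (Finset N)} {i : N} {σ : List (Finset N) → Bool} :
    i ∈ syncAct (Function.update s i σ) h ↔ σ h = true := by
  simp [syncAct]

/-- Once `i` has taken action `1`, irreversibility makes deviations of `i` void. -/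
theorem syncOutcomeFrom_update_of_mem (hs : ∀ i, IsSyncStrategy T i (s i)) {i : N}
    {σ : List (Finset N) → Bool} (hσ : IsSyncStrategy T i σ) (k : ℕ) :
    ∀ h : List (Finset N), IsSyncHistory h → h.length + k = T → i ∈ lastProfile h →
      syncOutcomeFrom T (Function.update s i σ) h = syncOutcomeFrom T s h := by
  induction k with
  | zero =>
    intro h _ hT _
    rw [syncOutcomeFrom_of_length_eq (by omega), syncOutcomeFrom_of_length_eq (by omega)]
  | succ k ih =>
    intro h hh hT hi
    have hlt : h.length < T := by omega
    have hact : syncAct (Function.update s i σ) h = syncAct s h := by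
      ext j
      rcases eq_or_ne j i with rfl | hne
      · rw [mem_syncAct_update_self, mem_syncAct, hσ h hh hlt hi, hs j h hh hlt hi]
      · exact mem_syncAct_update_of_ne hne
    have hsub := lastProfile_subset_syncAct hs hh hlt
    rw [syncOutcomeFrom_of_length_lt hlt, syncOutcomeFrom_of_length_lt hlt, hact]
    exact ih _ (hh.cons hsub) (by simp; omega) (hsub hi)

omit [DecidableEq N] in
theorem syncOutcomeFrom_mono (hs : ∀ i, IsSyncStrategy T i (s i)) (hm : IsSyncMonotone T s)
    (k : ℕ) : ∀ h h' : List (Finset N), IsSyncHistory h → IsSyncHistory h' → h.length + k = T →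
      List.Forall₂ (fun a b => a ⊆ b) h h' → syncOutcomeFrom T s h ⊆ syncOutcomeFrom T s h' := by
  induction k with
  | zero =>
    intro h h' _ _ hT hle
    have := hle.length_eq
    rw [syncOutcomeFrom_of_length_eq (by omega), syncOutcomeFrom_of_length_eq (by omega)]
    cases hle with
    | nil => exact subset_rfl
    | cons hab _ => exact hab
  | succ k ih =>
    intro h h' hh hh' hT hle
    have hlen := hle.length_eq
    have hlt : h.length < T := by omega
    have hlt' : h'.length < T := by omega
    rw [syncOutcomeFrom_of_length_lt hlt, syncOutcomeFrom_of_length_lt hlt']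
    refine ih _ _ (hh.cons (lastProfile_subset_syncAct hs hh hlt))
      (hh'.cons (lastProfile_subset_syncAct hs hh' hlt')) (by simp; omega) (.cons ?_ hle)
    intro i hi
    rw [mem_syncAct] at hi ⊢
    exact hm i h h' hh hh' hlt hle hi

/-- The outcome `Y` of a monotone equilibrium with `k` stages left is closed under `C k`. If
`j ∉ Y` moves at once instead, the resulting outcome contains `Y` and `j` and is closed under
`C (k - 1)` by induction, so it contains `C (k - 1) (Y ∪ j)`. -/
theorem syncOutcome_closed {u : N → Finset N → ℝ} (hu : IsCoordinationGame u)
    (hs : IsSyncSPNE u T s) (hm : IsSyncMonotone T s) (k : ℕ) :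
    ∀ h : List (Finset N), IsSyncHistory h → h.length + k = T →
      lastProfile h ⊆ syncOutcomeFrom T s h ∧
      syncClosure (Prefers u) k (syncOutcomeFrom T s h) = syncOutcomeFrom T s h := by
  have hP := prefers_mono hu
  induction k with
  | zero =>
    intro h _ hT
    rw [syncOutcomeFrom_of_length_eq (by omega)]
    exact ⟨subset_rfl, rfl⟩
  | succ k ih =>
    intro h hh hT
    have hlt : h.length < T := by omega
    have hsub := lastProfile_subset_syncAct hs.1 hh hlt
    obtain ⟨hX, hY⟩ := ih _ (hh.cons hsub) (by simp; omega)
    have hY' := syncOutcomeFrom_of_length_lt (s := s) hlt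
    rw [← hY'] at hX hY
    refine ⟨hsub.trans hX, Finset.Subset.antisymm (leastClosed_subset subset_rfl fun j hj => ?_)
      (subset_syncClosure _ _)⟩
    by_contra hn
    have hσ : IsSyncStrategy T j (fun _ => true) := fun _ _ _ _ => rfl
    have hact : syncAct (Function.update s j fun _ => true) h = insert j (syncAct s h) := by
      ext i
      rcases eq_or_ne i j with rfl | hne
      · simp [mem_syncAct_update_self]
      · simp [mem_syncAct_update_of_ne hne, hne]
    have hsub' := hsub.trans (Finset.subset_insert j _)
    have hdev := hs.2 h hh hlt j _ hσ
    rw [syncOutcomeFrom_of_length_lt hlt, hact, syncOutcomeFrom_update_of_mem hs.1 hσ k _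
      (hh.cons hsub') (by simp; omega) (Finset.mem_insert_self _ _)] at hdev
    obtain ⟨hXj, hYj⟩ := ih _ (hh.cons hsub') (by simp; omega)
    have hmono : syncOutcomeFrom T s h ⊆ syncOutcomeFrom T s (insert j (syncAct s h) :: h) := by
      rw [hY']
      exact syncOutcomeFrom_mono hs.1 hm k _ _ (hh.cons hsub) (hh.cons hsub') (by simp; omega)
        (.cons (Finset.subset_insert j _) (List.forall₂_same.2 fun _ _ => subset_rfl))
    have hmem := hXj (Finset.mem_insert_self _ _)
    refine absurd ((lt_iff_prefers hu hmono hn hmem).2 (hP j ?_ hj)) (not_lt.2 hdev)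
    rw [← hYj]
    exact syncClosure_mono k (Finset.insert_subset hmem hmono)

end Sync

section SyncEquilibrium

variable (P : N → Finset N → Prop) (T : ℕ)

/-- Everybody who belongs to the least outcome takes action `1` at once. -/
noncomputable def leastSyncStrategy (i : N) (h : List (Finset N)) : Bool :=
  decide (i ∈ syncClosure P (T - h.length) (lastProfile h))

variable {P T}

theorem syncAct_leastSyncStrategy {h : List (Finset N)} {k : ℕ} (hT : h.length + k = T) :
    syncAct (leastSyncStrategy P T) h = syncClosure P k (lastProfile h) := by
  have : T - h.length = k := by omega
  ext i
  simp [syncAct, leastSyncStrategy, this]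

theorem isSyncStrategy_leastSyncStrategy (i : N) :
    IsSyncStrategy T i (leastSyncStrategy P T i) := fun _ _ _ hi =>
  decide_eq_true (subset_syncClosure _ _ hi)

theorem isSyncMonotone_leastSyncStrategy : IsSyncMonotone T (leastSyncStrategy P T) := by
  intro i h h' _ _ _ hle hi
  have hlen := hle.length_eq
  simp only [leastSyncStrategy, decide_eq_true_eq] at hi ⊢
  rw [← hlen]
  refine syncClosure_mono _ ?_ hi
  cases hle with
  | nil => exact subset_rfl
  | cons hab _ => exact hab

theorem syncOutcomeFrom_leastSyncStrategy (hP : ∀ i, Monotone (P i)) (k : ℕ) :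
    ∀ h : List (Finset N), h.length + k = T →
      syncOutcomeFrom T (leastSyncStrategy P T) h = syncClosure P k (lastProfile h) := by
  induction k with
  | zero =>
    intro h hT
    rw [syncOutcomeFrom_of_length_eq (by omega)]
    rfl
  | succ k ih =>
    intro h hT
    rw [syncOutcomeFrom_of_length_lt (by omega), ih _ (by simp; omega),
      syncAct_leastSyncStrategy hT]
    exact syncClosure_syncClosure_succ hP k _

variable {i : N} {σ : List (Finset N) → Bool}

/-- A deviation of a player outside the least outcome either changes nothing or leads to an outcome at
which the player does not strictly prefer action `1`. -/
theorem sync_deviation_of_notMem (hP : ∀ i, Monotone (P i)) (hσ : IsSyncStrategy T i σ) (k : ℕ) :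
    ∀ h : List (Finset N), IsSyncHistory h → h.length + k = T →
      i ∉ syncClosure P k (lastProfile h) →
      syncOutcomeFrom T (Function.update (leastSyncStrategy P T) i σ) h =
          syncClosure P k (lastProfile h) ∨
        ∃ D, syncOutcomeFrom T (Function.update (leastSyncStrategy P T) i σ) h = D ∧ i ∈ D ∧
          ¬ P i D ∧ syncClosure P k (lastProfile h) ⊆ D := by
  induction k with
  | zero =>
    intro h _ hT _
    left
    rw [syncOutcomeFrom_of_length_eq (by omega)]
    rfl
  | succ k ih =>
    intro h hh hT hi
    have hlt : h.length < T := by omega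
    have hself := syncClosure_syncClosure_succ hP k (lastProfile h)
    have hsub := subset_syncClosure (P := P) (k + 1) (lastProfile h)
    have hothers : ∀ j, j ≠ i → (j ∈ syncAct (Function.update (leastSyncStrategy P T) i σ) h ↔
        j ∈ syncClosure P (k + 1) (lastProfile h)) := fun j hne => by
      rw [mem_syncAct_update_of_ne hne, syncAct_leastSyncStrategy hT]
    rw [syncOutcomeFrom_of_length_lt hlt]
    rcases hb : σ h with _ | _
    · have hact : syncAct (Function.update (leastSyncStrategy P T) i σ) h =
          syncClosure P (k + 1) (lastProfile h) := by
        ext j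
        rcases eq_or_ne j i with rfl | hne
        · simp [mem_syncAct_update_self, hb, hi]
        · exact hothers j hne
      rw [hact]
      have := ih _ (hh.cons hsub) (by simp; omega)
        (by rw [lastProfile, List.headD_cons, hself]; exact hi)
      simp only [lastProfile, List.headD_cons] at this hself
      rw [hself] at this
      exact this
    · have hact : syncAct (Function.update (leastSyncStrategy P T) i σ) h =
          insert i (syncClosure P (k + 1) (lastProfile h)) := by
        ext j
        rcases eq_or_ne j i with rfl | hne
        · simp [mem_syncAct_update_self, hb]
        · simp [hothers j hne, hne]
      rw [hact, syncOutcomeFrom_update_of_mem isSyncStrategy_leastSyncStrategy hσ k _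
        (hh.cons (hsub.trans (Finset.subset_insert _ _))) (by simp; omega)
        (Finset.mem_insert_self _ _),
        syncOutcomeFrom_leastSyncStrategy hP k _ (by simp; omega)]
      exact Or.inr ⟨_, rfl, subset_syncClosure _ _ (Finset.mem_insert_self _ _),
        fun h => hi (mem_syncClosure_succ hP h),
        (Finset.subset_insert _ _).trans (subset_syncClosure _ _)⟩

/-- If the play stays between `Z \ i` and a closed set `Z`, then a deviation of `i` ends in one of the
two. -/
theorem sync_deviation_of_mem (hP : ∀ i, Monotone (P i)) {Z : Finset N} (hi : i ∈ Z) (k : ℕ) :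
    ∀ h : List (Finset N), h.length + k = T → syncClosure P k Z = Z →
      Z.erase i ⊆ syncClosure P k (lastProfile h) → syncClosure P k (lastProfile h) ⊆ Z →
      syncOutcomeFrom T (Function.update (leastSyncStrategy P T) i σ) h = Z ∨
        syncOutcomeFrom T (Function.update (leastSyncStrategy P T) i σ) h = Z.erase i := by
  induction k with
  | zero =>
    intro h hT _ h1 h2
    rw [syncOutcomeFrom_of_length_eq (by omega)]
    change Z.erase i ⊆ lastProfile h at h1
    change lastProfile h ⊆ Z at h2
    by_cases hm : i ∈ lastProfile h
    · left
      refine Finset.Subset.antisymm h2 ?_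
      rw [← Finset.insert_erase hi]
      exact Finset.insert_subset hm h1
    · right
      exact Finset.Subset.antisymm (Finset.subset_erase.2 ⟨h2, hm⟩) h1
  | succ k ih =>
    intro h hT hZ h1 h2
    have hZ' := syncClosure_eq_self_of_succ hP hZ
    rw [syncOutcomeFrom_of_length_lt (by omega)]
    have hothers : ∀ j, j ≠ i → (j ∈ syncAct (Function.update (leastSyncStrategy P T) i σ) h ↔
        j ∈ syncClosure P (k + 1) (lastProfile h)) := fun j hne => by
      rw [mem_syncAct_update_of_ne hne, syncAct_leastSyncStrategy hT]
    refine ih _ (by simp; omega) hZ' ?_ ?_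
    · refine Finset.Subset.trans (fun j hj => ?_) (subset_syncClosure _ _)
      exact (hothers j (Finset.ne_of_mem_erase hj)).2 (h1 hj)
    · conv_rhs => rw [← hZ']
      refine syncClosure_mono k fun j hj => ?_
      rcases eq_or_ne j i with rfl | hne
      · exact hi
      · exact h2 ((hothers j hne).1 hj)

theorem isSyncSPNE_leastSyncStrategy {u : N → Finset N → ℝ} (hu : IsCoordinationGame u) (T : ℕ) :
    IsSyncSPNE u T (leastSyncStrategy (Prefers u) T) := by
  have hP := prefers_mono hu
  refine ⟨isSyncStrategy_leastSyncStrategy, fun h hh hlt i σ hσ => ?_⟩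
  obtain ⟨k, hT⟩ : ∃ k, h.length + k = T := ⟨T - h.length, by omega⟩
  rw [syncOutcomeFrom_leastSyncStrategy hP k h hT]
  by_cases hl : i ∈ lastProfile h
  · rw [syncOutcomeFrom_update_of_mem isSyncStrategy_leastSyncStrategy hσ k h hh hT hl,
      syncOutcomeFrom_leastSyncStrategy hP k h hT]
  by_cases hi : i ∈ syncClosure (Prefers u) k (lastProfile h)
  · rcases sync_deviation_of_mem (σ := σ) hP hi k h hT (syncClosure_idem hP k _)
      (Finset.erase_subset _ _) subset_rfl with e | e
    · rw [e]
    · rw [e]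
      exact ((lt_iff_prefers hu (Finset.erase_subset _ _) (Finset.notMem_erase _ _) hi).2
        (prefers_of_mem_syncClosure hP hi hl)).le
  · rcases sync_deviation_of_notMem hP hσ k h hh hT hi with e | ⟨D, e, hD, hPD, hsub⟩
    · rw [e]
    · rw [e]
      exact not_lt.1 fun hlt => hPD ((lt_iff_prefers hu hsub hi hD).1 hlt)

end SyncEquilibrium

theorem isLeast_syncOutcomes {u : N → Finset N → ℝ} (hu : IsCoordinationGame u) (T : ℕ) :
    IsLeast (syncOutcomes u T) (syncClosure (Prefers u) T ∅) := by
  have hP := prefers_mono hu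
  refine ⟨⟨_, isSyncSPNE_leastSyncStrategy hu T, isSyncMonotone_leastSyncStrategy,
    syncOutcomeFrom_leastSyncStrategy hP T [] (by simp)⟩, ?_⟩
  rintro _ ⟨s, hs, hm, rfl⟩
  have := (syncOutcome_closed hu hs hm T [] List.isChain_nil (by simp)).2
  rw [← this]
  exact syncClosure_mono T (Finset.empty_subset _)

theorem phi_eq_syncClosure {u : N → Finset N → ℝ} (hu : IsCoordinationGame u) (T : ℕ) :
    phi u T = syncClosure (Prefers u) T ∅ := by
  have h := isLeast_syncOutcomes hu T
  ext i
  simp only [phi, Finset.mem_filter, Finset.mem_univ, true_and]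
  exact ⟨fun hi => hi _ h.1, fun hi Y hY => h.2 hY hi⟩

/-! ### The asynchronous game -/

section Async

variable {T : ℕ} {p : N → Fin T} {s : N → Finset N → Bool}

/-- The history after period `t`, if `s` is followed in period `t` after the history `h`. -/
def asyncNext (p : N → Fin T) (s : N → Finset N → Bool) (t : ℕ) (h : Finset N) : Finset N :=
  h ∪ Finset.univ.filter (fun i => (p i : ℕ) = t ∧ s i h = true)

theorem asyncRun_succ (k t : ℕ) (h : Finset N) :
    asyncRun p s (k + 1) t h = asyncRun p s k (t + 1) (asyncNext p s t h) := rfl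

theorem mem_asyncNext {t : ℕ} {h : Finset N} {i : N} :
    i ∈ asyncNext p s t h ↔ i ∈ h ∨ ((p i : ℕ) = t ∧ s i h = true) := by
  simp [asyncNext]

theorem subset_asyncNext {t : ℕ} {h : Finset N} : h ⊆ asyncNext p s t h :=
  Finset.subset_union_left

omit [Fintype N] [DecidableEq N] in
theorem IsAsyncHistory.notMem {t : ℕ} {h : Finset N} (hh : IsAsyncHistory p t h) {i : N}
    (hi : t ≤ p i) : i ∉ h := fun hm => by
  have := hh i hm
  omega

theorem IsAsyncHistory.next {t : ℕ} {h : Finset N} (hh : IsAsyncHistory p t h) :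
    IsAsyncHistory p (t + 1) (asyncNext p s t h) := by
  intro j hj
  rcases mem_asyncNext.1 hj with hj | ⟨hj, _⟩
  · have := hh j hj
    omega
  · omega

omit [Fintype N] in
theorem IsAsyncHistory.insert {t : ℕ} {h : Finset N} (hh : IsAsyncHistory p t h) {i : N}
    (hi : (p i : ℕ) < t) : IsAsyncHistory p t (insert i h) := by
  intro j hj
  rcases Finset.mem_insert.1 hj with rfl | hj
  · exact hi
  · exact hh j hj

theorem subset_asyncRun (k : ℕ) : ∀ (t : ℕ) (h : Finset N), h ⊆ asyncRun p s k t h := by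
  induction k with
  | zero => exact fun _ _ => subset_rfl
  | succ k ih => exact fun t h => subset_asyncNext.trans (ih _ _)

theorem le_of_mem_asyncRun {i : N} (k : ℕ) : ∀ (t : ℕ) (h : Finset N), i ∈ asyncRun p s k t h →
    i ∉ h → t ≤ p i := by
  induction k with
  | zero => exact fun _ _ hi hn => absurd hi hn
  | succ k ih =>
    intro t h hi hn
    by_cases hm : i ∈ asyncNext p s t h
    · rcases mem_asyncNext.1 hm with h1 | h1
      · exact absurd h1 hn
      · exact h1.1.ge
    · have := ih _ _ hi hm
      omega

theorem asyncRun_mono (hm : IsAsyncMonotone p s) (k : ℕ) :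
    ∀ (t : ℕ) (h h' : Finset N), IsAsyncHistory p t h → IsAsyncHistory p t h' → h ⊆ h' →
      asyncRun p s k t h ⊆ asyncRun p s k t h' := by
  induction k with
  | zero => exact fun _ _ _ _ _ h => h
  | succ k ih =>
    intro t h h' hh hh' hle
    refine ih _ _ _ hh.next hh'.next fun i hi => ?_
    rcases mem_asyncNext.1 hi with h1 | ⟨rfl, h2⟩
    · exact mem_asyncNext.2 (Or.inl (hle h1))
    · exact mem_asyncNext.2 (Or.inr ⟨rfl, hm i h h' hh hh' hle h2⟩)

theorem asyncNext_update_of_ne {i : N} {σ : Finset N → Bool} {t : ℕ} (hne : (p i : ℕ) ≠ t)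
    (h : Finset N) : asyncNext p (Function.update s i σ) t h = asyncNext p s t h := by
  ext j
  rw [mem_asyncNext, mem_asyncNext]
  rcases eq_or_ne j i with rfl | hj
  · simp [hne]
  · rw [Function.update_of_ne hj]

/-- A player's strategy has no effect after the period in which the player moves. -/
theorem asyncRun_update_of_lt {i : N} {σ : Finset N → Bool} (k : ℕ) :
    ∀ (t : ℕ) (h : Finset N), (p i : ℕ) < t →
      asyncRun p (Function.update s i σ) k t h = asyncRun p s k t h := by
  induction k with
  | zero => exact fun _ _ _ => rfl
  | succ k ih =>
    intro t h hlt
    rw [asyncRun_succ, asyncRun_succ, ih _ _ (by omega), asyncNext_update_of_ne (by omega)]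

theorem asyncNext_update_self {i : N} {σ : Finset N → Bool} {h : Finset N} (hi : i ∉ h) :
    asyncNext p (Function.update s i σ) (p i) h =
      if σ h = true then insert i (asyncNext p s (p i) h) else (asyncNext p s (p i) h).erase i := by
  ext j
  rcases eq_or_ne j i with rfl | hj
  · split_ifs with hσ <;> simp [mem_asyncNext, hi, hσ]
  · split_ifs with hσ <;> simp [mem_asyncNext, hj]

theorem asyncOutcomeFrom_eq {k t : ℕ} (hT : t + k = T) (h : Finset N) :
    asyncOutcomeFrom p s t h = asyncRun p s k t h := by
  rw [asyncOutcomeFrom, show T - t = k by omega]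

/-- In a monotone equilibrium a player who takes action `0` would not strictly prefer action `1` at
the outcome that a switch to action `1` leads to. -/
theorem not_prefers_of_notMem_asyncNext {u : N → Finset N → ℝ} (hu : IsCoordinationGame u)
    (hs : IsAsyncSPNE u p s) (hm : IsAsyncMonotone p s) {k : ℕ} {h : Finset N} {i : N}
    (hT : (p i : ℕ) + (k + 1) = T) (hh : IsAsyncHistory p (p i) h)
    (hi : i ∉ asyncNext p s (p i) h) :
    ¬ Prefers u i (asyncRun p s k (p i + 1) (insert i (asyncNext p s (p i) h))) := by
  intro hpref
  have hdev := hs (p i) h (by omega) hh i (fun _ => true)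
  rw [asyncOutcomeFrom_eq hT, asyncOutcomeFrom_eq hT, asyncRun_succ, asyncRun_succ,
    asyncRun_update_of_lt _ _ _ (by omega), asyncNext_update_self (hh.notMem le_rfl),
    if_pos rfl] at hdev
  refine absurd ((lt_iff_prefers hu ?_ ?_ ?_).2 hpref) (not_lt.2 hdev)
  · exact asyncRun_mono hm k _ _ _ hh.next (hh.next.insert (by omega)) (Finset.subset_insert _ _)
  · intro hmem
    have := le_of_mem_asyncRun k _ _ hmem hi
    omega
  · exact subset_asyncRun _ _ _ (Finset.mem_insert_self _ _)

/-- If `i` still has to move and takes action `0` in the outcome of a subgame of a monotone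
equilibrium, then a later subgame in which `i` has taken action `1` has a larger outcome, at which `i`
does not strictly prefer action `1`. -/
theorem exists_switch {u : N → Finset N → ℝ} (hu : IsCoordinationGame u)
    (hs : IsAsyncSPNE u p s) (hm : IsAsyncMonotone p s) {i : N} (k : ℕ) :
    ∀ (t : ℕ) (h : Finset N), t + k = T → IsAsyncHistory p t h → t ≤ p i →
      i ∉ asyncRun p s k t h →
      ∃ (k' : ℕ) (h' : Finset N), ((p i : ℕ) + 1) + k' = T ∧ IsAsyncHistory p (p i + 1) h' ∧
        i ∈ h' ∧ asyncRun p s k t h ⊆ asyncRun p s k' (p i + 1) h' ∧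
        ¬ Prefers u i (asyncRun p s k' (p i + 1) h') := by
  induction k with
  | zero =>
    intro t h hT _ hti _
    have := (p i).isLt
    omega
  | succ k ih =>
    intro t h hT hh hti hi
    rcases eq_or_lt_of_le hti with rfl | hlt
    · have hi' : i ∉ asyncNext p s (p i) h := fun hmem => hi (subset_asyncRun k _ _ hmem)
      have hh' := (hh.next (s := s)).insert (i := i) (by omega)
      exact ⟨k, _, by omega, hh', Finset.mem_insert_self _ _,
        asyncRun_mono hm k _ _ _ hh.next hh' (Finset.subset_insert _ _),
        not_prefers_of_notMem_asyncNext hu hs hm hT hh hi'⟩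
    · exact ih _ _ (by omega) hh.next hlt hi

end Async

/-! ### The least equilibrium of the asynchronous game -/

section AsyncLeast

variable {T : ℕ} (P : N → Finset N → Prop) (p : N → Fin T)

/-- The outcome of the `k` periods from period `t` on, after the history `h`, when the players of every
period play the least equilibrium of the game induced by the later periods. -/
noncomputable def asyncLeast : ℕ → ℕ → Finset N → Finset N
  | 0, _, h => h
  | k + 1, t, h =>
      asyncLeast k (t + 1) (leastClosed (fun i Z => (p i : ℕ) = t ∧ P i (asyncLeast k (t + 1) Z)) h)

/-- The history after period `t` in the least equilibrium, when `k` periods follow. -/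
noncomputable def asyncLeastNext (k t : ℕ) (h : Finset N) : Finset N :=
  leastClosed (fun i Z => (p i : ℕ) = t ∧ P i (asyncLeast P p k (t + 1) Z)) h

/-- The strategies of the least equilibrium; `T - 1 - p i` periods follow the period of `i`. -/
noncomputable def leastAsyncStrategy (i : N) (h : Finset N) : Bool :=
  decide (i ∈ asyncLeastNext P p (T - 1 - p i) (p i) h)

variable {P p}

theorem asyncLeast_succ (k t : ℕ) (h : Finset N) :
    asyncLeast P p (k + 1) t h = asyncLeast P p k (t + 1) (asyncLeastNext P p k t h) := rfl

theorem asyncLeast_mono (k : ℕ) : ∀ t, Monotone (asyncLeast P p k t) := by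
  induction k with
  | zero => exact fun _ _ _ h => h
  | succ k ih => exact fun t => (ih (t + 1)).comp leastClosed_mono

theorem monotone_asyncDemand (hP : ∀ i, Monotone (P i)) (k t : ℕ) (i : N) :
    Monotone (fun Z => (p i : ℕ) = t ∧ P i (asyncLeast P p k (t + 1) Z)) :=
  fun _ _ hZ h => ⟨h.1, hP i (asyncLeast_mono k _ hZ) h.2⟩

theorem asyncNext_leastAsyncStrategy (hP : ∀ i, Monotone (P i)) {k t : ℕ} (hT : t + (k + 1) = T)
    (h : Finset N) : asyncNext p (leastAsyncStrategy P p) t h = asyncLeastNext P p k t h := by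
  ext i
  rw [mem_asyncNext]
  have hk : (p i : ℕ) = t → (leastAsyncStrategy P p i h = true ↔ i ∈ asyncLeastNext P p k t h) := by
    rintro rfl
    rw [leastAsyncStrategy, decide_eq_true_eq, show T - 1 - (p i : ℕ) = k by omega]
  constructor
  · rintro (hi | ⟨hi, hs⟩)
    · exact subset_leastClosed hi
    · exact (hk hi).1 hs
  · intro hi
    by_cases hn : i ∈ h
    · exact Or.inl hn
    · have := (demand_of_mem_leastClosed (monotone_asyncDemand hP k t) hi hn).1
      exact Or.inr ⟨this, (hk this).2 hi⟩

theorem asyncRun_leastAsyncStrategy (hP : ∀ i, Monotone (P i)) (k : ℕ) :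
    ∀ (t : ℕ) (h : Finset N), t + k = T →
      asyncRun p (leastAsyncStrategy P p) k t h = asyncLeast P p k t h := by
  induction k with
  | zero => exact fun _ _ _ => rfl
  | succ k ih =>
    intro t h hT
    rw [asyncRun_succ, asyncLeast_succ, asyncNext_leastAsyncStrategy hP hT, ih _ _ (by omega)]

theorem isAsyncMonotone_leastAsyncStrategy : IsAsyncMonotone p (leastAsyncStrategy P p) := by
  intro i h h' _ _ hle hi
  simp only [leastAsyncStrategy, decide_eq_true_eq] at hi ⊢
  exact leastClosed_mono hle hi

theorem isAsyncSPNE_leastAsyncStrategy {u : N → Finset N → ℝ} (hu : IsCoordinationGame u)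
    (p : N → Fin T) : IsAsyncSPNE u p (leastAsyncStrategy (Prefers u) p) := by
  have hP := prefers_mono hu
  have main : ∀ (i : N) (σ : Finset N → Bool) (k t : ℕ) (h : Finset N), t + k = T →
      IsAsyncHistory p t h →
      u i (asyncRun p (Function.update (leastAsyncStrategy (Prefers u) p) i σ) k t h) ≤
        u i (asyncRun p (leastAsyncStrategy (Prefers u) p) k t h) := by
    intro i σ k
    induction k with
    | zero => exact fun _ _ _ _ => le_rfl
    | succ k ih =>
      intro t h hT hh
      by_cases hne : (p i : ℕ) = t
      swap
      · rw [asyncRun_succ, asyncRun_succ, asyncNext_update_of_ne hne]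
        exact ih _ _ (by omega) hh.next
      subst hne
      set Z := asyncNext p (leastAsyncStrategy (Prefers u) p) (p i) h with hZ
      have hih : i ∉ h := hh.notMem le_rfl
      have hlate : ∀ Y, i ∉ Y →
          i ∉ asyncRun p (leastAsyncStrategy (Prefers u) p) k (p i + 1) Y := fun Y hY hmem => by
        have := le_of_mem_asyncRun k _ _ hmem hY
        omega
      have hrun := fun Y => asyncRun_leastAsyncStrategy (p := p) hP k (p i + 1) Y (by omega)
      have hZ' := hZ.trans (asyncNext_leastAsyncStrategy hP hT h)
      rw [asyncRun_succ, asyncRun_succ, asyncRun_update_of_lt _ _ _ (by omega),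
        asyncNext_update_self hih, ← hZ]
      split_ifs with hσ <;> by_cases hi : i ∈ Z
      · rw [Finset.insert_eq_of_mem hi]
      · refine not_lt.1 fun hlt => hi ?_
        rw [lt_iff_prefers hu (by rw [hrun, hrun]; exact asyncLeast_mono k _ (Finset.subset_insert _ _))
          (hlate Z hi) (subset_asyncRun _ _ _ (Finset.mem_insert_self _ _)), hrun] at hlt
        rw [hZ'] at hlt ⊢
        exact mem_leastClosed_of_demand (monotone_asyncDemand hP k _) ⟨rfl, hlt⟩
      · refine ((lt_iff_prefers hu ?_ (hlate _ (Finset.notMem_erase _ _))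
          (subset_asyncRun _ _ _ hi)).2 ?_).le
        · rw [hrun, hrun]
          exact asyncLeast_mono k _ (Finset.erase_subset _ _)
        · rw [hrun]
          rw [hZ'] at hi ⊢
          exact (demand_of_mem_leastClosed (monotone_asyncDemand hP k _) hi hih).2
      · rw [Finset.erase_eq_of_notMem hi]
  intro t h ht hh i σ
  exact main i σ (T - t) t h (by omega) hh

theorem asyncLeast_subset_asyncRun {u : N → Finset N → ℝ} (hu : IsCoordinationGame u)
    {s : N → Finset N → Bool} (hs : IsAsyncSPNE u p s) (hm : IsAsyncMonotone p s) (k : ℕ) :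
    ∀ (t : ℕ) (h : Finset N), t + k = T → IsAsyncHistory p t h →
      asyncLeast (Prefers u) p k t h ⊆ asyncRun p s k t h := by
  induction k with
  | zero => exact fun _ _ _ _ => subset_rfl
  | succ k ih =>
    intro t h hT hh
    refine Finset.Subset.trans (asyncLeast_mono k _ (leastClosed_subset subset_asyncNext ?_))
      (ih _ _ (by omega) hh.next)
    rintro j ⟨rfl, hj⟩
    by_contra hn
    exact not_prefers_of_notMem_asyncNext hu hs hm hT hh hn (prefers_mono hu j
      (ih _ _ (by omega) (hh.next.insert (by omega))) hj)

theorem isLeast_asyncOutcomes {u : N → Finset N → ℝ} (hu : IsCoordinationGame u)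
    (p : N → Fin T) : IsLeast (asyncOutcomes u p) (asyncLeast (Prefers u) p T 0 ∅) := by
  refine ⟨⟨_, isAsyncSPNE_leastAsyncStrategy hu p, isAsyncMonotone_leastAsyncStrategy,
    asyncRun_leastAsyncStrategy (prefers_mono hu) T 0 ∅ (by omega)⟩, ?_⟩
  rintro _ ⟨s, hs, hm, rfl⟩
  exact asyncLeast_subset_asyncRun hu hs hm T 0 ∅ (by omega) (by simp [IsAsyncHistory])

/-- Acting in separate periods never achieves more than acting simultaneously in all stages. -/
theorem asyncLeast_subset_syncClosure (hP : ∀ i, Monotone (P i)) (k : ℕ) :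
    ∀ (t : ℕ) (h : Finset N), asyncLeast P p k t h ⊆ syncClosure P k h := by
  induction k with
  | zero => exact fun _ _ => subset_rfl
  | succ k ih =>
    intro t h
    rw [← syncClosure_syncClosure_succ hP k h]
    refine Finset.Subset.trans (asyncLeast_mono k _ (leastClosed_subset
      (subset_syncClosure _ _) ?_)) (ih _ _)
    rintro j ⟨-, hj⟩
    exact mem_syncClosure_succ hP (hP j (ih _ _) hj)

end AsyncLeast

/-! ### The recursion -/

section Tau

variable {u : N → Finset N → ℝ} {S W : Finset N}

omit [Fintype N] in
theorem over_erase {i : N} (hi : i ∈ W) :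
    (AuxGame.mk S W).over (W.erase i) = ⟨insert i S, W.erase i⟩ := by
  have : W \ W.erase i = {i} := by
    ext j
    simp only [Finset.mem_sdiff, Finset.mem_erase, Finset.mem_singleton]
    constructor
    · tauto
    · rintro rfl
      simpa using hi
  simp only [AuxGame.over, this, AuxGame.mk.injEq, and_true]
  rw [Finset.union_comm, Finset.singleton_union]

omit [Fintype N] in
theorem over_sdiff {X : Finset N} (hX : X ⊆ W) :
    (AuxGame.mk S W).over (W \ X) = ⟨S ∪ X, W \ X⟩ := by
  simp only [AuxGame.over, Finset.sdiff_sdiff_eq_self hX]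

omit [Fintype N] in
theorem isDominated_iff {i : N} (hi : i ∉ S) :
    IsDominated u ⟨S, W⟩ i ↔ i ∈ W ∧ Prefers u i S := by
  simp only [IsDominated, AuxGame.payoff, Prefers, Finset.union_empty,
    Finset.erase_eq_of_notMem hi]
  rw [Finset.union_comm, Finset.singleton_union]

omit [Fintype N] in
theorem isSSS_iff {X : Finset N} (h : Disjoint S W) :
    IsSSS u ⟨S, W⟩ X ↔ X ⊆ W ∧ ∀ i ∈ X, Prefers u i (S ∪ X) := by
  refine and_congr_right fun hX => forall₂_congr fun i hi => ?_
  have hS : i ∉ S := fun hS => Finset.disjoint_left.1 h hS (hX hi)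
  rw [AuxGame.payoff, AuxGame.payoff, Prefers, Finset.insert_eq_of_mem
    (Finset.mem_union_right S hi), Finset.erase_union_distrib, Finset.erase_eq_of_notMem hS]

theorem tau_of_active_eq_empty {A : AuxGame N} (h : A.active = ∅) : tau u A = 1 := by
  rw [tau, if_pos h]

theorem tau_le_dominate {A : AuxGame N} {i : N} (h : IsDominated u A i) :
    tau u A ≤ tau u (A.over (A.active.erase i)) := by
  rw [tau, if_neg (Finset.ne_empty_of_mem h.1), if_pos ⟨i, h⟩]
  exact Nat.sInf_le ⟨i, h, rfl⟩

theorem tau_le_delete {A : AuxGame N} {i : N} (h : ¬ ∃ j, IsDominated u A j)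
    (hi : i ∈ A.active) : tau u A ≤ 1 + tau u (A.over (A.active.erase i)) := by
  rw [tau, if_neg (Finset.ne_empty_of_mem hi), if_neg h]
  exact Nat.sInf_le (Or.inl ⟨i, hi, rfl⟩)

theorem tau_le_divide {A : AuxGame N} {X : Finset N} (h : ¬ ∃ j, IsDominated u A j)
    (hX : IsSSS u A X ∧ X.Nonempty ∧ X ≠ A.active) :
    tau u A ≤ max (tau u (A.under X)) (tau u (A.over (A.active \ X))) := by
  rw [tau, if_neg (hX.2.1.mono hX.1.1).ne_empty, if_neg h]
  exact Nat.sInf_le (Or.inr ⟨X, hX, rfl⟩)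

theorem exists_isPolicyFunction (u : N → Finset N → ℝ) : ∃ π, IsPolicyFunction u π := by
  have key : ∀ A : AuxGame N, ∃ o : Op N, A.active.Nonempty →
      match o with
      | Op.dominate i => IsDominated u A i ∧ tau u A = tau u (A.over (A.active.erase i))
      | Op.delete i => (¬ ∃ j, IsDominated u A j) ∧ i ∈ A.active ∧
          tau u A = 1 + tau u (A.over (A.active.erase i))
      | Op.divide X => (¬ ∃ j, IsDominated u A j) ∧ (IsSSS u A X ∧ X.Nonempty ∧ X ≠ A.active) ∧
          tau u A = max (tau u (A.under X)) (tau u (A.over (A.active \ X))) := by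
    intro A
    by_cases hA : A.active.Nonempty
    swap
    -- nothing is required of the operation at a game without active players
    · exact ⟨Op.divide ∅, fun h => absurd h hA⟩
    by_cases hd : ∃ j, IsDominated u A j
    · have hmem := Nat.sInf_mem (s := {k | ∃ (i : N) (_ : IsDominated u A i),
        k = tau u (A.over (A.active.erase i))}) (hd.elim fun j hj => ⟨_, j, hj, rfl⟩)
      obtain ⟨i, hi, he⟩ := hmem
      refine ⟨Op.dominate i, fun _ => ⟨hi, ?_⟩⟩
      rw [tau, if_neg hA.ne_empty, if_pos hd, he]
    · have hmem := Nat.sInf_mem (s := {k | ∃ (i : N) (_ : i ∈ A.active),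
          k = 1 + tau u (A.over (A.active.erase i))} ∪
        {k | ∃ (X : Finset N) (_ : IsSSS u A X ∧ X.Nonempty ∧ X ≠ A.active),
          k = max (tau u (A.under X)) (tau u (A.over (A.active \ X)))})
        (hA.elim fun j hj => ⟨_, Or.inl ⟨j, hj, rfl⟩⟩)
      have htau := tau.eq_1 u A
      rw [if_neg hA.ne_empty, if_neg hd] at htau
      rcases hmem with ⟨i, hi, he⟩ | ⟨X, hX, he⟩
      · exact ⟨Op.delete i, fun _ => ⟨hd, hi, htau.trans he⟩⟩
      · exact ⟨Op.divide X, fun _ => ⟨hd, hX, htau.trans he⟩⟩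
  choose π hπ using key
  exact ⟨π, fun A hA => hπ A hA⟩

/-- The operations that a policy function can select, as an induction principle on games. -/
theorem IsPolicyFunction.induction {π : AuxGame N → Op N} (hπ : IsPolicyFunction u π)
    {motive : AuxGame N → Prop}
    (empty : ∀ A, A.active = ∅ → motive A)
    (dominate : ∀ A i, π A = Op.dominate i → IsDominated u A i →
      tau u A = tau u (A.over (A.active.erase i)) →
      motive (A.over (A.active.erase i)) → motive A)
    (delete : ∀ A i, π A = Op.delete i → i ∈ A.active →
      tau u A = 1 + tau u (A.over (A.active.erase i)) →
      motive (A.over (A.active.erase i)) → motive A)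
    (divide : ∀ A X, π A = Op.divide X → IsSSS u A X ∧ X.Nonempty ∧ X ≠ A.active →
      tau u A = max (tau u (A.under X)) (tau u (A.over (A.active \ X))) →
      motive (A.under X) → motive (A.over (A.active \ X)) → motive A)
    (A : AuxGame N) : motive A := by
  induction hn : A.active.card using Nat.strong_induction_on generalizing A with
  | _ n ih =>
    subst hn
    rcases A.active.eq_empty_or_nonempty with hA | hA
    · exact empty A hA
    have h := hπ A hA
    rcases hop : π A with i | i | X
    · rw [hop] at h
      exact dominate A i hop h.1 h.2 (ih _ (Finset.card_erase_lt_of_mem h.1.1) _ rfl)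
    · rw [hop] at h
      exact delete A i hop h.2.1 h.2.2 (ih _ (Finset.card_erase_lt_of_mem h.2.1) _ rfl)
    · rw [hop] at h
      exact divide A X hop h.2.1 h.2.2
        (ih _ (Finset.card_lt_card (lt_of_le_of_ne h.2.1.1.1 h.2.1.2.2)) _ rfl)
        (ih _ (Finset.card_lt_card (Finset.sdiff_ssubset h.2.1.1.1 h.2.1.2.1)) _ rfl)

theorem one_le_tau (u : N → Finset N → ℝ) (A : AuxGame N) : 1 ≤ tau u A := by
  obtain ⟨π, hπ⟩ := exists_isPolicyFunction u
  refine hπ.induction (motive := fun A => 1 ≤ tau u A) ?_ ?_ ?_ ?_ A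
  · exact fun A hA => (tau_of_active_eq_empty hA).ge
  · exact fun A i _ _ he ih => he ▸ ih
  · intro A i _ _ he _
    omega
  · exact fun A X _ _ he ih _ => he ▸ le_max_of_le_left ih

omit [Fintype N] in
theorem prefers_insert_iff {i : N} (hi : i ∉ S) : Prefers u i (insert i S) ↔ Prefers u i S := by
  rw [Prefers, Prefers, Finset.erase_insert hi, Finset.insert_idem, Finset.erase_eq_of_notMem hi]

/-- A bound on `τ` by dividing off the strictly sufficient set `V \ S`. -/
theorem tau_le_of_divide {U V : Finset N} {n : ℕ} (hSV : S ⊆ V) (hVU : V ⊆ U) (hne : V ≠ S)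
    (hneU : V ≠ U) (hpref : ∀ i ∈ V, i ∉ S → Prefers u i V)
    (hd : ¬ ∃ j, IsDominated u ⟨S, U \ S⟩ j) (h₁ : tau u ⟨S, V \ S⟩ ≤ n)
    (h₂ : tau u ⟨V, U \ V⟩ ≤ n) : tau u ⟨S, U \ S⟩ ≤ n := by
  have hsub : V \ S ⊆ U \ S := Finset.sdiff_subset_sdiff hVU subset_rfl
  have hX : IsSSS u ⟨S, U \ S⟩ (V \ S) ∧ (V \ S).Nonempty ∧ V \ S ≠ U \ S := by
    refine ⟨(isSSS_iff Finset.disjoint_sdiff).2 ⟨hsub, fun i hi => ?_⟩, ?_, fun he => hneU ?_⟩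
    · rw [Finset.union_sdiff_of_subset hSV]
      exact hpref i (Finset.mem_sdiff.1 hi).1 (Finset.mem_sdiff.1 hi).2
    · exact Finset.sdiff_nonempty.2 fun h => hne (Finset.Subset.antisymm h hSV)
    · rw [← Finset.union_sdiff_of_subset hSV, he, Finset.union_sdiff_of_subset (hSV.trans hVU)]
  refine (tau_le_divide hd hX).trans (max_le h₁ ?_)
  have hW : (U \ S) \ (V \ S) = U \ V := by
    ext j
    have := @hSV j
    simp only [Finset.mem_sdiff]
    tauto
  change tau u ((AuxGame.mk S (U \ S)).over ((U \ S) \ (V \ S))) ≤ n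
  rwa [over_sdiff hsub, Finset.union_sdiff_of_subset hSV, hW]

/-- The game of the players whom `C k` adds to `S` has value at most `k` (at most `1` if `k = 0`). With
no dominated player, either `C (k - 1)` adds some players, which can be divided off, or some `i`
prefers action `1` at `V = C (k - 1) (S ∪ i)`; then `V \ S` can be treated by deleting `i` first, and
the rest, if any, is divided off. -/
theorem tau_syncClosure_le (hu : IsCoordinationGame u) (k : ℕ) :
    ∀ S : Finset N, tau u ⟨S, syncClosure (Prefers u) k S \ S⟩ ≤ max 1 k := by
  have hP := prefers_mono hu
  induction k with
  | zero => exact fun S => (tau_of_active_eq_empty (by simp [syncClosure])).le.trans (le_max_left _ _)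
  | succ k ihk =>
    intro S
    obtain ⟨U, hU⟩ : ∃ U, syncClosure (Prefers u) (k + 1) S = U := ⟨_, rfl⟩
    rw [hU]
    induction hn : (U \ S).card using Nat.strong_induction_on generalizing S with
    | _ n ih =>
      subst hn
      have hSU : S ⊆ U := hU ▸ subset_syncClosure _ _
      -- the induction hypothesis applies to every starting set strictly between `S` and `U`
      have hrest : ∀ V, S ⊆ V → V ⊆ U → V ≠ S → tau u ⟨V, U \ V⟩ ≤ max 1 (k + 1) := by
        intro V hSV hVU hne
        refine ih _ (Finset.card_lt_card ?_) V ?_ rfl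
        · refine (Finset.ssubset_iff_subset_ne.2
            ⟨Finset.sdiff_subset_sdiff subset_rfl hSV, fun he => hne ?_⟩)
          rw [← Finset.sdiff_sdiff_eq_self hVU, he, Finset.sdiff_sdiff_eq_self hSU]
        · rw [syncClosure_eq_of_between hP hSV (hU ▸ hVU), hU]
      by_cases hd : ∃ j, IsDominated u ⟨S, U \ S⟩ j
      · obtain ⟨j, hj⟩ := hd
        have hjm : j ∈ U \ S := hj.1
        have hjU := (Finset.mem_sdiff.1 hjm).1
        have hjS := (Finset.mem_sdiff.1 hjm).2
        refine (tau_le_dominate hj).trans ?_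
        change tau u ((AuxGame.mk S (U \ S)).over ((U \ S).erase j)) ≤ _
        rw [over_erase hjm, ← Finset.sdiff_insert]
        exact hrest _ (Finset.subset_insert _ _) (Finset.insert_subset hjU hSU)
          (fun he => hjS (Finset.insert_eq_self.1 he))
      have hZU : syncClosure (Prefers u) k S ⊆ U := hU ▸ syncClosure_subset_succ hP k S
      have hmax : max 1 k ≤ max 1 (k + 1) := max_le_max le_rfl (Nat.le_succ k)
      by_cases hZ : syncClosure (Prefers u) k S = S
      swap
      · by_cases hZU' : syncClosure (Prefers u) k S = U
        · have := ihk S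
          rw [hZU'] at this
          exact this.trans hmax
        · exact tau_le_of_divide (subset_syncClosure _ _) hZU hZ hZU'
            (fun i hi hS => prefers_of_mem_syncClosure hP hi hS) hd ((ihk S).trans hmax)
            (hrest _ (subset_syncClosure _ _) hZU hZ)
      by_cases hUS : U = S
      · refine (tau_of_active_eq_empty ?_).le.trans (le_max_left _ _)
        simp [hUS]
      obtain ⟨i, hi, hiS⟩ : ∃ i, Prefers u i (syncClosure (Prefers u) k (insert i S)) ∧ i ∉ S := by
        by_contra! hcon
        exact hUS (Finset.Subset.antisymm (hU ▸ leastClosed_subset subset_rfl hcon) hSU)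
      have hiU : i ∈ U := by
        subst hU
        exact mem_syncClosure_succ hP (monotone_demand hP k i
          (Finset.insert_subset_insert i hSU) hi)
      have hiW : i ∈ U \ S := Finset.mem_sdiff.2 ⟨hiU, hiS⟩
      have hk : k ≠ 0 := by
        rintro rfl
        exact hd ⟨i, (isDominated_iff hiS).2 ⟨hiW, (prefers_insert_iff hiS).1 hi⟩⟩
      obtain ⟨V, hV⟩ : ∃ V, syncClosure (Prefers u) k (insert i S) = V := ⟨_, rfl⟩
      have hiV : insert i S ⊆ V := hV ▸ subset_syncClosure _ _
      have hSV : S ⊆ V := (Finset.subset_insert i S).trans hiV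
      have hmem : i ∈ V := hiV (Finset.mem_insert_self i S)
      have hVU : V ⊆ U := by
        subst hU
        rw [← hV, ← syncClosure_syncClosure_succ hP k S]
        exact syncClosure_mono k (Finset.insert_subset hiU hSU)
      have hpref : ∀ j ∈ V, j ∉ S → Prefers u j V := by
        intro j hj hjS
        subst hV
        rcases eq_or_ne j i with rfl | hne
        · exact hi
        · exact prefers_of_mem_syncClosure hP hj (by simp [hne, hjS])
      have htau : tau u ⟨S, V \ S⟩ ≤ max 1 (k + 1) := by
        have hd' : ¬ ∃ j, IsDominated u ⟨S, V \ S⟩ j := fun ⟨j, hj⟩ =>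
          hd ⟨j, Finset.sdiff_subset_sdiff hVU subset_rfl hj.1, hj.2⟩
        have hiW' : i ∈ V \ S := Finset.mem_sdiff.2 ⟨hmem, hiS⟩
        refine (tau_le_delete hd' hiW').trans ?_
        change 1 + tau u ((AuxGame.mk S (V \ S)).over ((V \ S).erase i)) ≤ _
        rw [over_erase hiW', ← Finset.sdiff_insert]
        have := ihk (insert i S)
        rw [hV] at this
        omega
      by_cases hVU' : V = U
      · rwa [hVU'] at htau
      · have hVS : V ≠ S := fun he => hiS (he ▸ hmem)
        exact tau_le_of_divide hSV hVU hVS hVU' hpref hd htau (hrest V hSV hVU hVS)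

end Tau

/-! ### Partitions read off a policy function -/

section ReadOff

variable {u : N → Finset N → ℝ} {T : ℕ} {π : AuxGame N → Op N}

theorem ReadOff.congr {p q : N → Fin T} {A : AuxGame N} (h : ReadOff π p A)
    (hπ : IsPolicyFunction u π) (hpq : ∀ j ∈ A.active, p j = q j) : ReadOff π q A := by
  induction h with
  | done A hA => exact .done A hA
  | dominate A i hA hop _ ih =>
    exact .dominate A i hA hop (ih fun j hj => hpq j (Finset.mem_of_mem_erase hj))
  | delete A i hA hop hi _ ih =>
    have h := hπ A hA
    rw [hop] at h
    refine .delete A i hA hop (fun j hj => ?_) (ih fun j hj => hpq j (Finset.mem_of_mem_erase hj))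
    rw [← hpq i h.2.1, ← hpq j (Finset.mem_of_mem_erase hj)]
    exact hi j hj
  | divide A X hA hop _ _ ih₁ ih₂ =>
    have h := hπ A hA
    rw [hop] at h
    exact .divide A X hA hop (ih₁ fun j hj => hpq j (h.2.1.1.1 hj))
      (ih₂ fun j hj => hpq j (Finset.sdiff_subset hj))

/-- If `τ ≤ n ≤ T`, a partition can be read off that places the active players in the last `n`
periods. -/
theorem exists_readOff (hπ : IsPolicyFunction u π) (hT : 1 ≤ T) (A : AuxGame N) :
    ∀ n ≤ T, tau u A ≤ n →
      ∃ p : N → Fin T, ReadOff π p A ∧ ∀ j ∈ A.active, T ≤ p j + n := by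
  refine hπ.induction (motive := fun A => ∀ n ≤ T, tau u A ≤ n →
      ∃ p : N → Fin T, ReadOff π p A ∧ ∀ j ∈ A.active, T ≤ p j + n) ?_ ?_ ?_ ?_ A
  · intro A hA n _ _
    exact ⟨fun _ => ⟨0, hT⟩, .done A hA, fun j hj => absurd hj (by simp [hA])⟩
  · intro A i hop hi he ih n hn htau
    have h1 := one_le_tau u A
    obtain ⟨p, hp, hlate⟩ := ih n hn (he ▸ htau)
    refine ⟨Function.update p i ⟨T - 1, by omega⟩, .dominate A i ⟨i, hi.1⟩ hop
      (hp.congr hπ fun j hj => ?_), fun j hj => ?_⟩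
    · rw [Function.update_of_ne (Finset.ne_of_mem_erase hj)]
    · rcases eq_or_ne j i with rfl | hne
      · simp only [Function.update_self]
        omega
      · rw [Function.update_of_ne hne]
        exact hlate j (Finset.mem_erase.2 ⟨hne, hj⟩)
  · intro A i hop hi he ih n hn htau
    have h1 := one_le_tau u (A.over (A.active.erase i))
    obtain ⟨p, hp, hlate⟩ := ih (n - 1) (by omega) (by omega)
    refine ⟨Function.update p i ⟨T - n, by omega⟩, .delete A i ⟨i, hi⟩ hop (fun j hj => ?_)
      (hp.congr hπ fun j hj => ?_), fun j hj => ?_⟩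
    · have := hlate j hj
      rw [Function.update_self, Function.update_of_ne (Finset.ne_of_mem_erase hj), Fin.lt_def]
      change T - n < (p j : ℕ)
      omega
    · rw [Function.update_of_ne (Finset.ne_of_mem_erase hj)]
    · rcases eq_or_ne j i with rfl | hne
      · simp only [Function.update_self]
        omega
      · rw [Function.update_of_ne hne]
        have := hlate j (Finset.mem_erase.2 ⟨hne, hj⟩)
        omega
  · intro A X hop hX he ih₁ ih₂ n hn htau
    rw [he] at htau
    obtain ⟨p, hp, hlate⟩ := ih₁ n hn ((le_max_left _ _).trans htau)
    obtain ⟨q, hq, hlate'⟩ := ih₂ n hn ((le_max_right _ _).trans htau)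
    refine ⟨fun j => if j ∈ X then p j else q j, .divide A X (hX.2.1.mono hX.1.1) hop
      (hp.congr hπ fun j hj => ?_) (hq.congr hπ fun j hj => ?_), fun j hj => ?_⟩
    · exact (if_pos hj).symm
    · exact (if_neg (Finset.mem_sdiff.1 hj).2).symm
    · by_cases hjX : j ∈ X
      · simp only [if_pos hjX]
        exact hlate j hjX
      · simp only [if_neg hjX]
        exact hlate' j (Finset.mem_sdiff.2 ⟨hj, hjX⟩)

/-- Take a subgame in which all active players still have to move. If they form a strictly sufficient
set, then every equilibrium outcome that contains the raised players contains them as well. For a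
deleted player `i` the reason is that after `i` has taken action `1` the claim holds in the later
subgame, so that `i` gains from taking action `1`. -/
theorem ReadOff.active_subset (hu : IsCoordinationGame u) {p : N → Fin T} {A : AuxGame N}
    (hA : ReadOff π p A) (hπ : IsPolicyFunction u π) {s : N → Finset N → Bool}
    (hs : IsAsyncSPNE u p s) (hm : IsAsyncMonotone p s) (hdisj : Disjoint A.raised A.active)
    (hsuff : ∀ i ∈ A.active, Prefers u i (A.raised ∪ A.active)) (k t : ℕ) (h : Finset N)
    (hT : t + k = T) (hh : IsAsyncHistory p t h) (hlate : ∀ i ∈ A.active, t ≤ p i)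
    (hraised : A.raised ⊆ asyncRun p s k t h) : A.active ⊆ asyncRun p s k t h := by
  have hP := prefers_mono hu
  have herase : ∀ {S W : Finset N} {i : N}, i ∈ W → insert i S ∪ W.erase i = S ∪ W := by
    intro S W i hi
    rw [Finset.insert_union, ← Finset.union_insert, Finset.insert_erase hi]
  have hdis : ∀ {S W : Finset N} {i : N}, Disjoint S W → Disjoint (insert i S) (W.erase i) := by
    intro S W i hd
    rw [Finset.disjoint_insert_left]
    exact ⟨Finset.notMem_erase _ _, hd.mono_right (Finset.erase_subset _ _)⟩
  induction hA generalizing k t h with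
  | done A hA => simp [hA]
  | dominate A i hA hop _ ih =>
    obtain ⟨S, W⟩ := A
    have hpol := hπ _ hA
    rw [hop] at hpol
    simp only at hdisj hsuff hlate hraised ih hpol ⊢
    have hiW : i ∈ W := hpol.1.1
    rw [over_erase hiW] at ih
    simp only [herase hiW] at ih
    have hiS : i ∉ S := fun hi => Finset.disjoint_left.1 hdisj hi hiW
    have hi : i ∈ asyncRun p s k t h := by
      by_contra hn
      obtain ⟨k', h', -, -, -, hsub, hnot⟩ := exists_switch hu hs hm k t h hT hh (hlate i hiW) hn
      exact hnot (hP i (hraised.trans hsub) ((isDominated_iff hiS).1 hpol.1).2)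
    have := ih (hdis hdisj) (fun j hj => hsuff j (Finset.mem_of_mem_erase hj)) k t h hT hh
      (fun j hj => hlate j (Finset.mem_of_mem_erase hj)) (Finset.insert_subset hi hraised)
    rw [← Finset.insert_erase hiW]
    exact Finset.insert_subset hi this
  | delete A i hA hop hfirst _ ih =>
    obtain ⟨S, W⟩ := A
    have hpol := hπ _ hA
    rw [hop] at hpol
    simp only at hdisj hsuff hlate hraised ih hpol hfirst ⊢
    have hiW : i ∈ W := hpol.2.1
    rw [over_erase hiW] at ih
    simp only [herase hiW] at ih
    have ih' := ih (hdis hdisj) (fun j hj => hsuff j (Finset.mem_of_mem_erase hj))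
    have hi : i ∈ asyncRun p s k t h := by
      by_contra hn
      obtain ⟨k', h', hT', hh', hih', hsub, hnot⟩ :=
        exists_switch hu hs hm k t h hT hh (hlate i hiW) hn
      have hins := Finset.insert_subset (subset_asyncRun (p := p) (s := s) k' (p i + 1) h' hih')
        (hraised.trans hsub)
      have := ih' k' _ h' hT' hh' (fun j hj => hfirst j hj) hins
      refine hnot (hP i ?_ (hsuff i hiW))
      rw [← herase hiW]
      exact Finset.union_subset hins this
    have := ih' k t h hT hh (fun j hj => hlate j (Finset.mem_of_mem_erase hj))
      (Finset.insert_subset hi hraised)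
    rw [← Finset.insert_erase hiW]
    exact Finset.insert_subset hi this
  | divide A X hA hop _ _ ih₁ ih₂ =>
    obtain ⟨S, W⟩ := A
    have hpol := hπ _ hA
    rw [hop] at hpol
    simp only at hdisj hsuff hlate hraised hpol ih₁ ih₂ ⊢
    obtain ⟨hXW, hXs⟩ := (isSSS_iff hdisj).1 hpol.2.1.1
    rw [over_sdiff hXW] at ih₂
    have h₁ : X ⊆ asyncRun p s k t h := ih₁ (hdisj.mono_right hXW) hXs k t h hT hh
      (fun j hj => hlate j (hXW hj)) hraised
    have h₂ : W \ X ⊆ asyncRun p s k t h := by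
      refine ih₂ ?_ ?_ k t h hT hh (fun j hj => hlate j (Finset.sdiff_subset hj))
        (Finset.union_subset hraised h₁)
      · exact Finset.disjoint_union_left.2
          ⟨hdisj.mono_right Finset.sdiff_subset, Finset.disjoint_sdiff⟩
      · intro j hj
        simp only [Finset.union_assoc, Finset.union_sdiff_of_subset hXW]
        exact hsuff j (Finset.sdiff_subset hj)
    rw [← Finset.union_sdiff_of_subset hXW]
    exact Finset.union_subset h₁ h₂

theorem ReadOff.subset_of_mem_asyncOutcomes (hu : IsCoordinationGame u) {p : N → Fin T}
    (hπ : IsPolicyFunction u π) {X Y : Finset N} (hX : IsSSS u (AuxGame.full N) X)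
    (hp : ReadOff π p ((AuxGame.full N).under X)) (hY : Y ∈ asyncOutcomes u p) : X ⊆ Y := by
  obtain ⟨s, hs, hm, rfl⟩ := hY
  exact hp.active_subset hu hπ hs hm (Finset.disjoint_empty_left _)
    ((isSSS_iff (Finset.disjoint_empty_left _)).1 hX).2 T 0 ∅ (by omega)
    (by simp [IsAsyncHistory]) (fun _ _ => Nat.zero_le _) (Finset.empty_subset _)

end ReadOff

end Coord

theorem mainTheorem1 {N : Type*} [Fintype N] [DecidableEq N] (u : N → Finset N → ℝ)
    (hu : Coord.IsCoordinationGame u) (T : ℕ) (hT : 1 ≤ T) :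
    -- every asynchronous game has a least MSPNE outcome, and so has the synchronous game
    (∀ p : N → Fin T, ∃ L, IsLeast (Coord.asyncOutcomes u p) L) ∧
    IsLeast (Coord.syncOutcomes u T) (Coord.phi u T) ∧
    -- the greatest least outcome over all partitions is the least outcome of the synchronous game
    IsGreatest {L | ∃ p : N → Fin T, IsLeast (Coord.asyncOutcomes u p) L} (Coord.phi u T) ∧
    -- this outcome is found by the recursion
    IsGreatest {Y | Coord.IsSSS u (Coord.AuxGame.full N) Y ∧
      Coord.tau u ((Coord.AuxGame.full N).under Y) ≤ T} (Coord.phi u T) ∧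
    -- optimal partitions are read off the policy functions of the recursion
    (∃ π, Coord.IsPolicyFunction u π) ∧
    ∀ π, Coord.IsPolicyFunction u π →
      (∃ p : N → Fin T, Coord.ReadOff π p ((Coord.AuxGame.full N).under (Coord.phi u T))) ∧
      ∀ p : N → Fin T, Coord.ReadOff π p ((Coord.AuxGame.full N).under (Coord.phi u T)) →
        IsLeast (Coord.asyncOutcomes u p) (Coord.phi u T) := by
  have hP := Coord.prefers_mono hu
  have hsync := Coord.isLeast_syncOutcomes hu T
  have hphi := Coord.phi_eq_syncClosure hu T
  rw [← hphi] at hsync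
  have hupper : ∀ (p : N → Fin T) L, IsLeast (Coord.asyncOutcomes u p) L → L ⊆ Coord.phi u T := by
    intro p L hL
    rw [hL.unique (Coord.isLeast_asyncOutcomes hu p), hphi]
    exact Coord.asyncLeast_subset_syncClosure hP T 0 ∅
  have hsss : Coord.IsSSS u (Coord.AuxGame.full N) (Coord.phi u T) := by
    refine (Coord.isSSS_iff (Finset.disjoint_empty_left _)).2
      ⟨Finset.subset_univ _, fun i hi => ?_⟩
    rw [Finset.empty_union, hphi]
    exact Coord.prefers_of_mem_syncClosure hP (hphi ▸ hi) (Finset.notMem_empty i)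
  have htau : Coord.tau u ((Coord.AuxGame.full N).under (Coord.phi u T)) ≤ T := by
    have := Coord.tau_syncClosure_le hu T ∅
    rwa [← hphi, Finset.sdiff_empty, max_eq_right hT] at this
  have hopt : ∀ π, Coord.IsPolicyFunction u π → ∀ p : N → Fin T,
      Coord.ReadOff π p ((Coord.AuxGame.full N).under (Coord.phi u T)) →
      IsLeast (Coord.asyncOutcomes u p) (Coord.phi u T) := by
    intro π hπ p hp
    have hL := Coord.isLeast_asyncOutcomes hu p
    have heq := Finset.Subset.antisymm (hp.subset_of_mem_asyncOutcomes hu hπ hsss hL.1)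
      (hupper p _ hL)
    rwa [← heq] at hL
  obtain ⟨π, hπ⟩ := Coord.exists_isPolicyFunction u
  refine ⟨fun p => ⟨_, Coord.isLeast_asyncOutcomes hu p⟩, hsync, ⟨?_, ?_⟩, ⟨⟨hsss, htau⟩, ?_⟩,
    ⟨π, hπ⟩, fun π' hπ' => ⟨?_, hopt π' hπ'⟩⟩
  · obtain ⟨p, hp, -⟩ := Coord.exists_readOff hπ hT _ T le_rfl htau
    exact ⟨p, hopt π hπ p hp⟩
  · rintro L ⟨p, hL⟩
    exact hupper p L hL
  · rintro Y ⟨hY, hYT⟩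
    obtain ⟨p, hp, -⟩ := Coord.exists_readOff hπ hT _ T le_rfl hYT
    have hL := Coord.isLeast_asyncOutcomes hu p
    exact (hp.subset_of_mem_asyncOutcomes hu hπ hY hL.1).trans (hupper p _ hL)
  · obtain ⟨p, hp, -⟩ := Coord.exists_readOff hπ' hT _ T le_rfl htau
    exact ⟨p, hp⟩
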